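/- **Corollary (semi-device independent simulability test, statistical models).** For $d\ge 1$, an effect on $\mathbb C^d$ is a matrix $\pi$ with $0\le\pi\le\mathbb 1$. For a family $\rho=(\rho_1,\dots,\rho_n)$ of $n$ states (positive semidefinite, unit trace) on $\mathbb C^d$ and a Hermitian $X$ put $\rho(X)=(\mathrm{Tr}[\rho_1X],\dots,\mathrm{Tr}[\rho_nX])\in\mathbb R^n$. For $0\le k\le d$ let $Q_k\in\mathbb R^{n\times n}$ be the matrix $$(Q_k)_{ij}=\Bigl(k-\frac{k^2}{d}\Bigr)\Bigl(\mathrm{Tr}[\rho_i\rho_j]-\frac1d\Bigr),$$ let $Q_k^+$ be its Moore–Penrose pseudo-inverse and $u=(1,\dots,1)$. For real $r\neq 0$ let $\mathcal E_r^k(\rho)$ be the (possibly degenerate) ellipsoid of all $q\in\mathbb R^n$ of the form $q=\rho(X)$, $X$ Hermitian, such that $$q-\tfrac kd u\in\operatorname{range}Q_k\quad\text{and}\quad\bigl|\sqrt{Q_k^+}\,(q-\tfrac kd u)\bigr|_2^2\le \frac1{r^2}.$$ The support of $\rho$ is the real linear span of $\rho_1,\dots,\rho_n$ in the space of Hermitian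 matrices. Let $\boldsymbol\rho_1=(\rho_{1,i})_{i=1}^n$ be a family of $n$ states on $\mathbb C^{d_1}$, and let $\mathcal Q\subseteq\mathbb R^n$ be a set of vectors generated by it, i.e. every element of $\mathcal Q$ is $\boldsymbol\rho_1(\pi)$ for some effect $\pi$ on $\mathbb C^{d_1}$. Let $d_0$ be any dimension and $\boldsymbol\rho_0=(\rho_{0,i})_{i=1}^n$ any family of $n$ states on $\mathbb C^{d_0}$ such that $$\operatorname{conv}\bigcup_{k=0}^{d_0}\mathcal E_1^k(\boldsymbol\rho_0)\subseteq\operatorname{conv}\mathcal Q .$$ 1. There is a linear map $\mathcal C$ from the Hermitian operators on $\mathbb C^{d_1}$ to those on $\mathbb C^{d_0}$ (not necessarily trace preserving) with $\mathcal C(\rho_{1,i})=\rho_{0,i}$ for all $i$ (that is, $\mathcal C\circ\boldsymbol\rho_1=\boldsymbol\rho_0$) that is positive on the support of $\boldsymbol\rho_1$: $\mathcal C(X)\ge0$ for every $X\ge 0$ in the support of $\boldsymbol\rho_1$. 2. If moreover $d_1=d_0=2$ and $n=2$, then $\mathcal C$ can be taken completely positive and trace preserving: there is a quantum channel $\mathcal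 C$ with $\mathcal C\circ\boldsymbol\rho_1=\boldsymbol\rho_0$. -/

import Mathlib

open scoped Matrix ComplexOrder

/-- A `d`-dimensional quantum state: a positive semidefinite matrix of unit trace. -/
def IsQState {d : ℕ} (ρ : Matrix (Fin d) (Fin d) ℂ) : Prop :=
  ρ.PosSemidef ∧ ρ.trace = 1

/-- A `d`-dimensional effect: `0 ≤ π ≤ 1`. -/
def IsQEffect {d : ℕ} (π : Matrix (Fin d) (Fin d) ℂ) : Prop :=
  π.PosSemidef ∧ (1 - π).PosSemidef

/-- A `d`-dimensional statistical model: a family of `n` states. -/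
def IsStatModel {n d : ℕ} (ρ : Fin n → Matrix (Fin d) (Fin d) ℂ) : Prop :=
  ∀ i, IsQState (ρ i)

/-- The action of a family on a Hermitian operator: `ρ(X) = (Tr[ρ₁ X], …, Tr[ρₙ X])`
(the traces are real when all the matrices are Hermitian). -/
noncomputable def modelVec {n d : ℕ} (ρ : Fin n → Matrix (Fin d) (Fin d) ℂ)
    (X : Matrix (Fin d) (Fin d) ℂ) : Fin n → ℝ :=
  fun i => (ρ i * X).trace.re

/-- The testing region `ρ(𝔼)`: the image of the set of effects. -/
def testingRegion {n d : ℕ} (ρ : Fin n → Matrix (Fin d) (Fin d) ℂ) : Set (Fin n → ℝ) :=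
  {q | ∃ π : Matrix (Fin d) (Fin d) ℂ, IsQEffect π ∧ modelVec ρ π = q}

/-- The covariance matrix `(Q_k)_{ij} = (k - k²/d) (Tr[ρᵢ ρⱼ] - 1/d)`. -/
noncomputable def covMatrix {n d : ℕ} (ρ : Fin n → Matrix (Fin d) (Fin d) ℂ) (k : ℕ) :
    Matrix (Fin n) (Fin n) ℝ :=
  Matrix.of fun i j => ((k : ℝ) - (k : ℝ) ^ 2 / d) * ((ρ i * ρ j).trace.re - 1 / d)

/-- The Moore-Penrose pseudo-inverse of a real symmetric matrix: nonzero eigenvalues are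
inverted and the kernel is kept (recall `0⁻¹ = 0`). See `symmPinv_penrose`. -/
noncomputable def symmPinv {n : ℕ} (Q : Matrix (Fin n) (Fin n) ℝ) :
    Matrix (Fin n) (Fin n) ℝ :=
  cfc (fun x : ℝ => x⁻¹) Q

/-- The square root `√A` of a real symmetric positive semidefinite matrix. -/
noncomputable def symmSqrt {n : ℕ} (A : Matrix (Fin n) (Fin n) ℝ) :
    Matrix (Fin n) (Fin n) ℝ :=
  cfc Real.sqrt A

/-- `symmPinv` satisfies the four Penrose equations. -/
theorem symmPinv_penrose {n : ℕ} (Q : Matrix (Fin n) (Fin n) ℝ) (hQ : Qᵀ = Q) :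
    Q * symmPinv Q * Q = Q ∧ symmPinv Q * Q * symmPinv Q = symmPinv Q ∧
      (Q * symmPinv Q)ᵀ = Q * symmPinv Q ∧ (symmPinv Q * Q)ᵀ = symmPinv Q * Q := by
  have hs : IsSelfAdjoint Q := by
    rw [isSelfAdjoint_iff, Matrix.star_eq_conjTranspose, Matrix.conjTranspose_eq_transpose_of_trivial, hQ]
  have hfin : (spectrum ℝ Q).Finite := Matrix.finite_real_spectrum
  have hc : ∀ f : ℝ → ℝ, ContinuousOn f (spectrum ℝ Q) := fun f => hfin.continuousOn f
  have h1 : Q = cfc (fun x : ℝ => x) Q := (cfc_id' ℝ Q hs).symm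
  have h2 : Q * symmPinv Q = cfc (fun x : ℝ => x * x⁻¹) Q := by
    rw [cfc_mul _ _ Q (hc _) (hc _), ← h1]; rfl
  have h3 : symmPinv Q * Q = cfc (fun x : ℝ => x⁻¹ * x) Q := by
    rw [cfc_mul _ _ Q (hc _) (hc _), ← h1]; rfl
  have hsym : ∀ f : ℝ → ℝ, (cfc f Q)ᵀ = cfc f Q := fun f => by
    have h := cfc_predicate (R := ℝ) (p := IsSelfAdjoint) f Q
    rwa [isSelfAdjoint_iff, Matrix.star_eq_conjTranspose,
      Matrix.conjTranspose_eq_transpose_of_trivial] at h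
  refine ⟨?_, ?_, ?_, ?_⟩
  · calc Q * symmPinv Q * Q = cfc (fun x : ℝ => x * x⁻¹ * x) Q := by
          rw [cfc_mul _ _ Q (hc _) (hc _), ← h1, ← h2]
      _ = cfc (fun x : ℝ => x) Q := by simp only [mul_inv_mul_cancel]
      _ = Q := h1.symm
  · calc symmPinv Q * Q * symmPinv Q = cfc (fun x : ℝ => x⁻¹ * x * x⁻¹) Q := by
          rw [cfc_mul _ _ Q (hc _) (hc _), ← h3]; rfl
      _ = symmPinv Q := by
          simp only [symmPinv]; congr 1; ext x
          by_cases h : x = 0 <;> simp [h]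
  · rw [h2, hsym]
  · rw [h3, hsym]

/-- The hyper-ellipsoid `𝓔_r^k(ρ)` with centre `(k/d) u`, `u = (1, …, 1)`, and covariance `Q_k`:
the `q ∈ ρ(𝓛(ℂᵈ))` with `q - (k/d) u` in the range of `Q_k` and
`|√(Q_k⁺) (q - (k/d) u)|₂² ≤ 1/r²`. The range condition matters when `Q_k` is singular; in
particular `𝓔_r^0(ρ) = {0}` and `𝓔_r^d(ρ) = {u}`. -/
noncomputable def modelEllipsoid {n d : ℕ} (ρ : Fin n → Matrix (Fin d) (Fin d) ℂ) (r : ℝ) (k : ℕ) :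
    Set (Fin n → ℝ) :=
  {q | (∃ X : Matrix (Fin d) (Fin d) ℂ, X.IsHermitian ∧ modelVec ρ X = q) ∧
    (∃ w : Fin n → ℝ, covMatrix ρ k *ᵥ w = fun i => q i - (k : ℝ) / d) ∧
    ‖WithLp.toLp 2 (symmSqrt (symmPinv (covMatrix ρ k)) *ᵥ fun i => q i - (k : ℝ) / d)‖ ^ 2
      ≤ 1 / r ^ 2}

/-- `conv ⋃_{k = 0}^d 𝓔_r^k(ρ)`. -/
def modelDCone {n d : ℕ} (ρ : Fin n → Matrix (Fin d) (Fin d) ℂ) (r : ℝ) :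
    Set (Fin n → ℝ) :=
  convexHull ℝ (⋃ k ∈ Finset.range (d + 1), modelEllipsoid ρ r k)

/-- The support of a family inside the real space of Hermitian operators: the span of its
elements, i.e. the Hilbert-Schmidt orthogonal complement of the kernel of `X ↦ ρ(X)`. -/
noncomputable def modelSupport {n d : ℕ} (ρ : Fin n → Matrix (Fin d) (Fin d) ℂ) :
    Submodule ℝ (Matrix (Fin d) (Fin d) ℂ) :=
  Submodule.span ℝ (Set.range ρ)

/-- A complex-linear map that restricts to a (real-linear) map between the spaces of Hermitian
operators. -/
def IsHermitianPreserving {d d' : ℕ}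
    (C : Matrix (Fin d) (Fin d) ℂ →ₗ[ℂ] Matrix (Fin d') (Fin d') ℂ) : Prop :=
  ∀ X, X.IsHermitian → (C X).IsHermitian

/-- `C` is positive on the set `S` of operators. -/
def IsPositiveOn {d d' : ℕ}
    (C : Matrix (Fin d) (Fin d) ℂ →ₗ[ℂ] Matrix (Fin d') (Fin d') ℂ)
    (S : Set (Matrix (Fin d) (Fin d) ℂ)) : Prop :=
  ∀ X ∈ S, X.PosSemidef → (C X).PosSemidef

section Channel

open scoped CStarAlgebra MatrixOrder Matrix.Norms.L2Operator

/-- `C` is completely positive, in Mathlib's sense, for the C⋆-algebras of complex matrices. -/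
def IsCPMap {d d' : ℕ}
    (C : Matrix (Fin d) (Fin d) ℂ →ₗ[ℂ] Matrix (Fin d') (Fin d') ℂ) : Prop :=
  ∃ Φ : Matrix (Fin d) (Fin d) ℂ →CP Matrix (Fin d') (Fin d') ℂ, Φ.toLinearMap = C

end Channel

/-- A quantum channel: completely positive and trace preserving. -/
def IsQChannel {d d' : ℕ}
    (C : Matrix (Fin d) (Fin d) ℂ →ₗ[ℂ] Matrix (Fin d') (Fin d') ℂ) : Prop :=
  IsCPMap C ∧ ∀ X, (C X).trace = X.trace

/-! Both claims follow from one inclusion: the testing region of $\rho_0$ lies in that of $\rho_1$.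
Every effect is a convex combination of projections, and a projection of rank $k$ gives a point of
$\mathcal E_1^k(\rho_0)$ because $Q_k$ is a multiple of the Gram matrix of the traceless parts
$\rho_i-\mathbb 1/d$ (`testingRegion_subset_modelDCone`). Hence the region of $\rho_0$ lies in the
hull of the ellipsoids, so in $\operatorname{conv}\mathcal Q$, and so in the convex region of
$\rho_1$.

Part 1 is duality: $\sum t_i\rho_{1,i}\ge0$ makes $t$ nonnegative on the larger region, hence on the
smaller, hence $\sum t_i\rho_{0,i}\ge0$. Applied to $\pm t$, this also shows that
$\rho_{1,i}\mapsto\rho_{0,i}$ is well defined on the span.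

Part 2 is the Alberti-Uhlmann theorem for qubit pairs. The line through two distinct states contains
two pure states $\alpha,\beta$, corresponding to states $S,T$ on the target side. Comparing largest
eigenvalues gives $\det(a\alpha-b\beta)\le\det(aS-bT)$ for $a,b>0$ (`det_re_le_of_effects`).
Optimizing over $a/b$ gives $\mathrm{Tr}[\alpha\beta]\le\mathrm{Tr}[ST]+2\sqrt{\det S\det T}$, which
compares squared fidelities. A channel $\alpha\mapsto S$, $\beta\mapsto T$ is then built from
factorizations of $S,T$ that attain their fidelity (`exists_isQChannel_pure_pair`). -/

section TraceForm

/-! ### Positivity of the trace pairing; projections as effects. -/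

theorem Matrix.PosSemidef.exists_mul_conjTranspose {d : ℕ} {A : Matrix (Fin d) (Fin d) ℂ}
    (hA : A.PosSemidef) : ∃ B : Matrix (Fin d) (Fin d) ℂ, A = B * Bᴴ := by
  open scoped MatrixOrder Matrix.Norms.L2Operator in
  obtain ⟨B, hB⟩ := CStarAlgebra.nonneg_iff_eq_star_mul_self.mp (Matrix.nonneg_iff_posSemidef.mpr hA)
  exact ⟨Bᴴ, by simpa [Matrix.star_eq_conjTranspose] using hB⟩

theorem Matrix.PosSemidef.trace_mul_nonneg {d : ℕ} {A B : Matrix (Fin d) (Fin d) ℂ}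
    (hA : A.PosSemidef) (hB : B.PosSemidef) : 0 ≤ (A * B).trace := by
  obtain ⟨C, rfl⟩ := hB.exists_mul_conjTranspose
  rw [← Matrix.mul_assoc, Matrix.trace_mul_comm, ← Matrix.mul_assoc]
  exact (hA.conjTranspose_mul_mul_same C).trace_nonneg

theorem Matrix.PosSemidef.of_isHermitian_of_mul_self {d : ℕ} {P : Matrix (Fin d) (Fin d) ℂ}
    (hP : P.IsHermitian) (h : P * P = P) : P.PosSemidef := by
  have := Matrix.posSemidef_conjTranspose_mul_self P
  rwa [hP.eq, h] at this

theorem IsQEffect.of_isHermitian_of_mul_self {d : ℕ} {P : Matrix (Fin d) (Fin d) ℂ}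
    (hP : P.IsHermitian) (h : P * P = P) : IsQEffect P := by
  refine ⟨.of_isHermitian_of_mul_self hP h,
    .of_isHermitian_of_mul_self (Matrix.isHermitian_one.sub hP) ?_⟩
  simp [sub_mul, mul_sub, h]

end TraceForm

/-! ### The testing region lies in the hull of the ellipsoids. -/

section Ellipsoid

/-- The weights represent the orthogonal projection of `y` onto the span of the `x i`, so linear
independence is not needed. -/
theorem exists_gram_solution {E : Type*} [NormedAddCommGroup E] [InnerProductSpace ℝ E]
    {n : ℕ} (x : Fin n → E) (y : E) :
    ∃ w : Fin n → ℝ, (∀ i, inner ℝ (x i) (∑ j, w j • x j) = inner ℝ (x i) y) ∧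
      ‖∑ j, w j • x j‖ ≤ ‖y‖ := by
  let K := Submodule.span ℝ (Set.range x)
  have : FiniteDimensional ℝ K := FiniteDimensional.span_of_finite ℝ (Set.finite_range x)
  obtain ⟨w, hw⟩ := (Submodule.mem_span_range_iff_exists_fun ℝ).mp (K.starProjection_apply_mem y)
  refine ⟨w, fun i => ?_, ?_⟩
  · rw [hw]
    have := K.starProjection_inner_eq_zero y (x i) (Submodule.subset_span ⟨i, rfl⟩)
    rw [real_inner_comm, inner_sub_right] at this
    linarith
  · rw [hw]
    exact K.norm_starProjection_apply_le y

/-- The left side is $w^TQQ^+Qw$, and $QQ^+Q=Q$. On the range of $Q$ the ellipsoid inequality thus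
becomes a bound on a quadratic form. The spectrum is finite, so every function is continuous on it.
-/
theorem norm_sq_symmSqrt_symmPinv_mulVec {n : ℕ} {Q : Matrix (Fin n) (Fin n) ℝ}
    (hQ : Q.PosSemidef) (w : Fin n → ℝ) :
    ‖WithLp.toLp 2 (symmSqrt (symmPinv Q) *ᵥ (Q *ᵥ w))‖ ^ 2 = w ⬝ᵥ Q *ᵥ w := by
  have hs : IsSelfAdjoint Q := hQ.isHermitian
  have hfin : (spectrum ℝ Q).Finite := Matrix.finite_real_spectrum
  have hc : ∀ f : ℝ → ℝ, ContinuousOn f (spectrum ℝ Q) := fun f => hfin.continuousOn f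
  have hpos := (Matrix.posSemidef_iff_isHermitian_and_spectrum_nonneg.mp hQ).2
  have hQt : Qᵀ = Q := by simpa using hQ.isHermitian.eq
  set S := symmSqrt (symmPinv Q) with hS
  have hSS : S * S = symmPinv Q := by
    have h1 : S = cfc (fun x : ℝ => Real.sqrt x⁻¹) Q := by
      rw [hS, symmSqrt, symmPinv, ← cfc_comp' Real.sqrt (fun x : ℝ => x⁻¹) Q
        ((hfin.image _).continuousOn _) (hc _)]
    rw [h1, ← cfc_mul _ _ Q (hc _) (hc _), symmPinv]
    exact cfc_congr fun x hx => Real.mul_self_sqrt (inv_nonneg.mpr (hpos hx))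
  have hSt : Sᵀ = S := by
    have h := cfc_predicate (R := ℝ) (p := IsSelfAdjoint) Real.sqrt (symmPinv Q)
    rwa [isSelfAdjoint_iff, Matrix.star_eq_conjTranspose,
      Matrix.conjTranspose_eq_transpose_of_trivial] at h
  calc _ = (S *ᵥ (Q *ᵥ w)) ⬝ᵥ (S *ᵥ (Q *ᵥ w)) := by
        rw [EuclideanSpace.norm_sq_eq]; simp [dotProduct, sq]
    _ = w ⬝ᵥ (Q * (S * S) * Q) *ᵥ w := by
        rw [Matrix.dotProduct_mulVec, Matrix.dotProduct_mulVec, ← Matrix.mulVec_transpose,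
          ← Matrix.mulVec_transpose, hSt, hQt, Matrix.mulVec_mulVec, Matrix.mulVec_mulVec,
          Matrix.mulVec_mulVec, dotProduct_comm]
        simp [Matrix.mul_assoc]
    _ = _ := by rw [hSS, (symmPinv_penrose Q hQt).1]

/-- The vector of entries of a matrix, in the Hilbert-Schmidt inner product space. -/
noncomputable def hsVec {d : ℕ} :
    Matrix (Fin d) (Fin d) ℂ →ₗ[ℝ] EuclideanSpace ℂ (Fin d × Fin d) where
  toFun X := WithLp.toLp 2 fun p => X p.1 p.2
  map_add' _ _ := rfl
  map_smul' _ _ := rfl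

attribute [local instance] InnerProductSpace.complexToReal

theorem hsVec_apply {d : ℕ} (X : Matrix (Fin d) (Fin d) ℂ) (p : Fin d × Fin d) :
    hsVec X p = X p.1 p.2 := rfl

theorem inner_hsVec {d : ℕ} {X : Matrix (Fin d) (Fin d) ℂ} (hX : X.IsHermitian)
    (Y : Matrix (Fin d) (Fin d) ℂ) : inner ℝ (hsVec X) (hsVec Y) = (X * Y).trace.re := by
  calc inner ℝ (hsVec X) (hsVec Y) = ∑ i, ∑ j, (Y i j * star (X i j)).re := by
        rw [real_inner_eq_re_inner ℂ, PiLp.inner_apply, Fintype.sum_prod_type]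
        simp [hsVec_apply]
    _ = ∑ j, ∑ i, (X j i * Y i j).re := by
        rw [Finset.sum_comm]
        congr! 2 with j _ i
        rw [hX.apply, mul_comm]
    _ = (X * Y).trace.re := by simp [Matrix.trace, Matrix.mul_apply]

theorem IsQState.isHermitian {d : ℕ} {ρ : Matrix (Fin d) (Fin d) ℂ} (h : IsQState ρ) :
    ρ.IsHermitian := h.1.isHermitian

theorem Matrix.isHermitian_real_smul_one {d : ℕ} (c : ℝ) :
    (c • (1 : Matrix (Fin d) (Fin d) ℂ)).IsHermitian := by
  simp [Matrix.IsHermitian]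

theorem re_trace_sub_smul_one_mul_sub_smul_one {d : ℕ} (X Y : Matrix (Fin d) (Fin d) ℂ)
    (a b : ℝ) :
    ((X - a • 1) * (Y - b • 1)).trace.re
      = (X * Y).trace.re - b * X.trace.re - a * Y.trace.re + a * b * d := by
  simp [sub_mul, mul_sub]
  ring

/-- With $x_i=\rho_i-\mathbb 1/d$ and $y=P-\tfrac kd\mathbb 1$, the centred vector is $\langle
x_i,y\rangle$, $\|y\|^2=\kappa=k-k^2/d$, and $Q_k$ is $\kappa$ times the Gram matrix of $x$. The
ellipsoid inequality says that projecting $y$ onto the span of the $x_i$ does not lengthen it. -/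
theorem modelVec_mem_modelEllipsoid {n d : ℕ} {ρ : Fin n → Matrix (Fin d) (Fin d) ℂ}
    (hρ : IsStatModel ρ) {P : Matrix (Fin d) (Fin d) ℂ} (hP : P.IsHermitian) (hPP : P * P = P)
    {k : ℕ} (hk : P.trace = k) : modelVec ρ P ∈ modelEllipsoid ρ 1 k := by
  let x : Fin n → EuclideanSpace ℂ (Fin d × Fin d) :=
    fun i => hsVec (ρ i - (1 / d : ℝ) • (1 : Matrix (Fin d) (Fin d) ℂ))
  let y : EuclideanSpace ℂ (Fin d × Fin d) :=
    hsVec (P - (k / d : ℝ) • (1 : Matrix (Fin d) (Fin d) ℂ))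
  -- Only a nonempty family excludes $d=0$, whence the dependence on an index.
  have hd : ∀ i : Fin n, (d : ℝ) ≠ 0 := by
    rintro i h
    obtain rfl : d = 0 := by exact_mod_cast h
    simpa using (hρ i).2
  have hx : ∀ i, (ρ i - (1 / d : ℝ) • (1 : Matrix (Fin d) (Fin d) ℂ)).IsHermitian := fun i =>
    (hρ i).isHermitian.sub (Matrix.isHermitian_real_smul_one _)
  have hxx : ∀ i j, inner ℝ (x i) (x j) = (ρ i * ρ j).trace.re - 1 / d := fun i j => by
    have := hd i
    simp only [x]
    rw [inner_hsVec (hx i), re_trace_sub_smul_one_mul_sub_smul_one, (hρ i).2, (hρ j).2]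
    simp only [Complex.one_re]
    field_simp
    ring
  have hxy : ∀ i, inner ℝ (x i) y = modelVec ρ P i - k / d := fun i => by
    have := hd i
    simp only [x, y, modelVec]
    rw [inner_hsVec (hx i), re_trace_sub_smul_one_mul_sub_smul_one, (hρ i).2, hk]
    simp only [Complex.one_re, Complex.natCast_re]
    field_simp
    ring
  have hyy : ‖y‖ ^ 2 = k - (k : ℝ) ^ 2 / d := by
    rw [← real_inner_self_eq_norm_sq]
    simp only [y]
    rw [inner_hsVec (hP.sub (Matrix.isHermitian_real_smul_one _)),
      re_trace_sub_smul_one_mul_sub_smul_one, hPP, hk]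
    simp only [Complex.natCast_re]
    rcases eq_or_ne (d : ℝ) 0 with h | h
    · simp [h]
    · field_simp
      ring
  set κ : ℝ := k - (k : ℝ) ^ 2 / d with hκ
  have hκ0 : 0 ≤ κ := hyy ▸ sq_nonneg _
  have hQmul : ∀ w : Fin n → ℝ, ∀ i,
      (covMatrix ρ k *ᵥ w) i = κ * inner ℝ (x i) (∑ j, w j • x j) := fun w i => by
    simp only [covMatrix, Matrix.mulVec, dotProduct, Matrix.of_apply, inner_sum, inner_smul_right,
      hxx, Finset.mul_sum]
    exact Finset.sum_congr rfl fun j _ => by ring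
  have hQquad : ∀ w : Fin n → ℝ, w ⬝ᵥ covMatrix ρ k *ᵥ w = κ * ‖∑ j, w j • x j‖ ^ 2 := fun w => by
    rw [← real_inner_self_eq_norm_sq, sum_inner, Finset.mul_sum]
    simp only [dotProduct, hQmul, inner_smul_left]
    exact Finset.sum_congr rfl fun j _ => by simp; ring
  have hQ : (covMatrix ρ k).PosSemidef := by
    refine .of_dotProduct_mulVec_nonneg ?_ fun w => ?_
    · ext i j
      simp [covMatrix, Matrix.trace_mul_comm (ρ i)]
    · rw [star_trivial, hQquad]
      positivity
  obtain ⟨w, hw, hwy⟩ := exists_gram_solution x y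
  -- If $\kappa=0$ then $y=0$ and both sides vanish, in agreement with $0^{-1}=0$.
  have hrange : covMatrix ρ k *ᵥ (κ⁻¹ • w) = fun i => modelVec ρ P i - (k : ℝ) / d := by
    ext i
    rw [Matrix.mulVec_smul, Pi.smul_apply, hQmul, hw, smul_eq_mul, ← hxy]
    rcases eq_or_ne κ 0 with h | h
    · rw [h, sq_eq_zero_iff, norm_eq_zero] at hyy
      simp [hyy]
    · field_simp
  refine ⟨⟨P, hP, rfl⟩, ⟨_, hrange⟩, ?_⟩
  rw [← hrange, norm_sq_symmSqrt_symmPinv_mulVec hQ, hQquad]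
  have hsum : ∑ j, (κ⁻¹ • w) j • x j = κ⁻¹ • ∑ j, w j • x j := by
    simp [Finset.smul_sum, smul_smul]
  have hle : ‖∑ j, w j • x j‖ ^ 2 ≤ κ := hyy ▸ pow_le_pow_left₀ (norm_nonneg _) hwy 2
  rw [hsum, norm_smul, mul_pow, Real.norm_eq_abs, sq_abs]
  calc κ * (κ⁻¹ ^ 2 * ‖∑ j, w j • x j‖ ^ 2) ≤ κ * (κ⁻¹ ^ 2 * κ) := by gcongr
    _ = (κ * κ⁻¹) ^ 2 := by ring
    _ ≤ 1 / 1 ^ 2 := by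
      rcases eq_or_ne κ 0 with h | h
      · simp [h]
      · simp [h]

theorem convexHull_pair_zero_one_pi {ι : Type*} [Finite ι] :
    convexHull ℝ (Set.univ.pi fun _ : ι => ({0, 1} : Set ℝ)) = Set.univ.pi fun _ => Set.Icc 0 1 := by
  rw [convexHull_pi]
  simp [convexHull_pair, segment_eq_Icc]

/-- In an eigenbasis of the effect the eigenvalues form a point of the cube $[0,1]^d$, the hull of
its vertices. A vertex is a projection whose rank is its number of ones. -/
theorem testingRegion_subset_modelDCone {n d : ℕ} {ρ : Fin n → Matrix (Fin d) (Fin d) ℂ}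
    (hρ : IsStatModel ρ) : testingRegion ρ ⊆ modelDCone ρ 1 := by
  rintro _ ⟨π, ⟨h0, h1⟩, rfl⟩
  have hH := h0.isHermitian
  let U : Matrix (Fin d) (Fin d) ℂ := hH.eigenvectorUnitary
  have hUU : Uᴴ * U = 1 := Unitary.coe_star_mul_self hH.eigenvectorUnitary
  let D : (Fin d → ℝ) → Matrix (Fin d) (Fin d) ℂ :=
    fun c => U * Matrix.diagonal (fun i => (c i : ℂ)) * Uᴴ
  let f : (Fin d → ℝ) →ₗ[ℝ] (Fin n → ℝ) :=
    { toFun := fun c => modelVec ρ (D c)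
      map_add' := fun a b => by
        ext i
        have : D (a + b) = D a + D b := by
          simp only [D, ← Matrix.add_mul, ← Matrix.mul_add, Matrix.diagonal_add]
          simp
        simp [modelVec, this, Matrix.mul_add]
      map_smul' := fun r a => by
        ext i
        have : D (r • a) = r • D a := by
          simp only [D]
          rw [← Matrix.smul_mul, ← Matrix.mul_smul, ← Matrix.diagonal_smul]
          congr 3
          ext i
          simp
        simp [modelVec, this] }
  have hπ : π = D hH.eigenvalues := by
    conv_lhs => rw [hH.spectral_theorem]
    rfl
  have hmem : hH.eigenvalues ∈ convexHull ℝ (Set.univ.pi fun _ : Fin d => ({0, 1} : Set ℝ)) := by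
    rw [convexHull_pair_zero_one_pi]
    refine fun i _ => ⟨h0.eigenvalues_nonneg i, ?_⟩
    have h2 := (h1.conjTranspose_mul_mul_same U).diag_nonneg (i := i)
    have h3 : Uᴴ * (1 - π) * U = 1 - Matrix.diagonal (fun i => (hH.eigenvalues i : ℂ)) := by
      rw [congrArg (fun M => Uᴴ * (1 - M) * U) hπ, mul_sub, sub_mul, mul_one, hUU]
      simp only [D]
      rw [← Matrix.mul_assoc, ← Matrix.mul_assoc, hUU, one_mul, Matrix.mul_assoc, hUU, mul_one]
    rw [h3] at h2
    have h4 : (hH.eigenvalues i : ℂ) ≤ 1 := by simpa using h2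
    exact_mod_cast h4
  have himg : modelVec ρ π ∈ convexHull ℝ (f '' Set.univ.pi fun _ : Fin d => ({0, 1} : Set ℝ)) := by
    rw [← f.image_convexHull]
    exact ⟨_, hmem, by simp [f, ← hπ]⟩
  refine convexHull_mono ?_ himg
  rintro _ ⟨c, hc, rfl⟩
  have hc' : ∀ i, c i = 0 ∨ c i = 1 := fun i => by simpa using hc i trivial
  let s : Finset (Fin d) := {i | c i = 1}
  have hcs : ∑ i, (c i : ℂ) = s.card := by
    rw [← Finset.sum_boole]
    refine Finset.sum_congr rfl fun i _ => ?_
    rcases hc' i with h | h <;> simp [h]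
  simp only [Set.mem_iUnion, Finset.mem_range]
  refine ⟨s.card, Nat.lt_succ_of_le (by simpa using s.card_le_univ),
    modelVec_mem_modelEllipsoid hρ (P := D c) ?_ ?_ ?_⟩
  · simp only [D]
    refine Matrix.isHermitian_mul_mul_conjTranspose U ?_
    simp [Matrix.IsHermitian, Matrix.diagonal_conjTranspose, Pi.star_def]
  · simp only [D]
    rw [show U * Matrix.diagonal (fun i => (c i : ℂ)) * Uᴴ
        * (U * Matrix.diagonal (fun i => (c i : ℂ)) * Uᴴ)
        = U * (Matrix.diagonal (fun i => (c i : ℂ)) * (Uᴴ * U)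
          * Matrix.diagonal (fun i => (c i : ℂ))) * Uᴴ by simp only [Matrix.mul_assoc], hUU, mul_one,
      Matrix.diagonal_mul_diagonal]
    congr 3
    ext i
    rcases hc' i with h | h <;> simp [h]
  · simp only [D]
    rw [Matrix.trace_mul_comm, ← Matrix.mul_assoc, hUU, one_mul, Matrix.trace_diagonal, hcs]

theorem convex_testingRegion {n d : ℕ} (ρ : Fin n → Matrix (Fin d) (Fin d) ℂ) :
    Convex ℝ (testingRegion ρ) := by
  rintro _ ⟨π, hπ, rfl⟩ _ ⟨τ, hτ, rfl⟩ a b ha hb hab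
  refine ⟨a • π + b • τ, ⟨(hπ.1.smul ha).add (hτ.1.smul hb), ?_⟩, ?_⟩
  · have : 1 - (a • π + b • τ) = a • (1 - π) + b • (1 - τ) := by
      rw [smul_sub, smul_sub, sub_add_sub_comm, ← add_smul, hab, one_smul]
    rw [this]
    exact (hπ.2.smul ha).add (hτ.2.smul hb)
  · ext i
    simp [modelVec, Matrix.mul_add]

end Ellipsoid

/-! ### Duality: a map positive on the support. -/

section PositiveOnSupport

theorem modelVec_dotProduct {n d : ℕ} (ρ : Fin n → Matrix (Fin d) (Fin d) ℂ) (t : Fin n → ℝ)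
    (π : Matrix (Fin d) (Fin d) ℂ) :
    t ⬝ᵥ modelVec ρ π = ((∑ i, t i • ρ i) * π).trace.re := by
  simp [modelVec, dotProduct, Finset.sum_mul, Matrix.trace_sum]

theorem exists_effect_of_testingRegion_subset {n d d' : ℕ} {ρ : Fin n → Matrix (Fin d) (Fin d) ℂ}
    {σ : Fin n → Matrix (Fin d') (Fin d') ℂ} (h : testingRegion σ ⊆ testingRegion ρ)
    {π : Matrix (Fin d') (Fin d') ℂ} (hπ : IsQEffect π) :
    ∃ τ : Matrix (Fin d) (Fin d) ℂ, IsQEffect τ ∧ ∀ t : Fin n → ℝ,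
      ((∑ i, t i • σ i) * π).trace.re = ((∑ i, t i • ρ i) * τ).trace.re := by
  obtain ⟨τ, hτ, e⟩ := h ⟨π, hπ, rfl⟩
  exact ⟨τ, hτ, fun t => by rw [← modelVec_dotProduct, ← modelVec_dotProduct, e]⟩

/-- Rank-one projections suffice as test effects: the one onto `x` yields the quadratic form at `x`
up to the factor $1/r$. -/
theorem Matrix.IsHermitian.posSemidef_of_effect_nonneg {d : ℕ} {A : Matrix (Fin d) (Fin d) ℂ}
    (hA : A.IsHermitian) (h : ∀ π, IsQEffect π → 0 ≤ (A * π).trace.re) : A.PosSemidef := by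
  refine .of_dotProduct_mulVec_nonneg hA fun x => ?_
  obtain ⟨r, hr0, hr⟩ : ∃ r : ℝ, 0 ≤ r ∧ star x ⬝ᵥ x = r :=
    ⟨_, (Complex.nonneg_iff.mp (dotProduct_star_self_nonneg x)).1,
      Complex.ext rfl (Complex.nonneg_iff.mp (dotProduct_star_self_nonneg x)).2.symm⟩
  rcases eq_or_ne r 0 with rfl | hr'
  · obtain rfl : x = 0 := by simpa using hr
    simp
  have key : IsQEffect (r⁻¹ • Matrix.vecMulVec x (star x)) := by
    refine .of_isHermitian_of_mul_self ?_ ?_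
    · simp [Matrix.IsHermitian, Matrix.conjTranspose_vecMulVec]
    · simp only [Matrix.smul_mul, Matrix.mul_smul, Matrix.vecMulVec_mul_vecMulVec, hr]
      simp [hr']
  have h2 := h _ key
  have h3 : (A * (r⁻¹ • Matrix.vecMulVec x (star x))).trace = r⁻¹ • (star x ⬝ᵥ A *ᵥ x) := by
    rw [Matrix.mul_smul, Matrix.trace_smul, Matrix.mul_vecMulVec, Matrix.trace_vecMulVec,
      dotProduct_comm]
  rw [h3] at h2
  rw [Complex.nonneg_iff]
  refine ⟨?_, (hA.im_star_dotProduct_mulVec_self x).symm⟩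
  rw [Complex.real_smul, Complex.re_ofReal_mul] at h2
  exact nonneg_of_mul_nonneg_right h2 (inv_pos.mpr (hr0.lt_of_ne' hr'))

/-- Each effect on the $\sigma$ side can be replaced by one on the $\rho$ side with the same
statistics, where the pairing with a positive operator is nonnegative. -/
theorem posSemidef_sum_of_testingRegion_subset {n d d' : ℕ}
    {ρ : Fin n → Matrix (Fin d) (Fin d) ℂ} {σ : Fin n → Matrix (Fin d') (Fin d') ℂ}
    (hσ : IsStatModel σ) (h : testingRegion σ ⊆ testingRegion ρ) (t : Fin n → ℝ)
    (ht : (∑ i, t i • ρ i).PosSemidef) : (∑ i, t i • σ i).PosSemidef := by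
  refine Matrix.IsHermitian.posSemidef_of_effect_nonneg ?_ fun π hπ => ?_
  · simp [Matrix.IsHermitian, Matrix.conjTranspose_sum, (hσ _).isHermitian.eq]
  · obtain ⟨τ, hτ, e⟩ := exists_effect_of_testingRegion_subset h hπ
    rw [e]
    exact (Complex.nonneg_iff.mp (ht.trace_mul_nonneg hτ.1)).1

/-- Positivity transfers for both `t` and `-t`, and the cone is pointed. -/
theorem sum_eq_zero_of_testingRegion_subset {n d d' : ℕ}
    {ρ : Fin n → Matrix (Fin d) (Fin d) ℂ} {σ : Fin n → Matrix (Fin d') (Fin d') ℂ}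
    (hσ : IsStatModel σ) (h : testingRegion σ ⊆ testingRegion ρ) (t : Fin n → ℝ)
    (ht : ∑ i, t i • ρ i = 0) : ∑ i, t i • σ i = 0 := by
  have h1 := posSemidef_sum_of_testingRegion_subset hσ h t (ht ▸ .zero)
  have h2 := posSemidef_sum_of_testingRegion_subset hσ h (-t) (by simp [ht, Matrix.PosSemidef.zero])
  open scoped MatrixOrder in
  refine le_antisymm (?_ : _ ≤ (0 : Matrix (Fin d') (Fin d') ℂ)) (Matrix.nonneg_iff_posSemidef.mpr h1)
  rw [Matrix.le_iff]
  simpa using h2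

/-- The Hermitian part `(X + Xᴴ) / 2` of a matrix. -/
noncomputable def hermitianPart {d : ℕ} :
    Matrix (Fin d) (Fin d) ℂ →ₗ[ℝ] Matrix (Fin d) (Fin d) ℂ where
  toFun X := (1 / 2 : ℝ) • (X + Xᴴ)
  map_add' X Y := by rw [Matrix.conjTranspose_add, ← smul_add, add_add_add_comm]
  map_smul' r X := by
    rw [Matrix.conjTranspose_smul, star_trivial, ← smul_add, smul_comm, RingHom.id_apply]

theorem hermitianPart_apply {d : ℕ} (X : Matrix (Fin d) (Fin d) ℂ) :
    hermitianPart X = (1 / 2 : ℝ) • (X + Xᴴ) := rfl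

theorem isHermitian_hermitianPart {d : ℕ} (X : Matrix (Fin d) (Fin d) ℂ) :
    (hermitianPart X).IsHermitian := by
  rw [hermitianPart_apply, Matrix.IsHermitian, Matrix.conjTranspose_smul, star_trivial,
    Matrix.conjTranspose_add, Matrix.conjTranspose_conjTranspose, add_comm]

theorem hermitianPart_eq_self {d : ℕ} {X : Matrix (Fin d) (Fin d) ℂ} (hX : X.IsHermitian) :
    hermitianPart X = X := by
  rw [hermitianPart_apply, hX.eq, ← two_smul ℝ X, smul_smul]
  norm_num

/-- A real-linear map defined on a Hermitian family extends to a Hermitian preserving one. -/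
theorem exists_isHermitianPreserving_comp_eq {n d d' : ℕ}
    {ρ : Fin n → Matrix (Fin d) (Fin d) ℂ} {σ : Fin n → Matrix (Fin d') (Fin d') ℂ}
    (hρ : ∀ i, (ρ i).IsHermitian) (hσ : ∀ i, (σ i).IsHermitian)
    (h : ∀ t : Fin n → ℝ, ∑ i, t i • ρ i = 0 → ∑ i, t i • σ i = 0) :
    ∃ C : Matrix (Fin d) (Fin d) ℂ →ₗ[ℂ] Matrix (Fin d') (Fin d') ℂ,
      IsHermitianPreserving C ∧ C ∘ ρ = σ := by
  obtain ⟨L, hL⟩ : ∃ L : Matrix (Fin d) (Fin d) ℂ →ₗ[ℝ] Matrix (Fin d') (Fin d') ℂ,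
      ∀ i, L (ρ i) = σ i := by
    let f := Fintype.linearCombination ℝ ρ
    let g := Fintype.linearCombination ℝ σ
    have hker : LinearMap.ker f ≤ LinearMap.ker g := fun t ht => by
      simp only [LinearMap.mem_ker, f, g, Fintype.linearCombination_apply] at ht ⊢
      exact h t ht
    -- The map on the span is $g$ factored through $\mathbb R^n/\ker f\cong\operatorname{range}f$,
    -- then extended to all matrices.
    obtain ⟨L, hL⟩ := ((LinearMap.ker f).liftQ g hker ∘ₗ
      f.quotKerEquivRange.symm.toLinearMap).exists_extend
    refine ⟨L, fun i => ?_⟩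
    have h1 := LinearMap.congr_fun hL ⟨f (Pi.single i 1), LinearMap.mem_range_self _ _⟩
    have h2 := f.quotKerEquivRange_symm_apply_image (Pi.single i 1) (LinearMap.mem_range_self _ _)
    simp only [LinearMap.comp_apply, Submodule.subtype_apply, LinearEquiv.coe_coe, h2] at h1
    simpa [f, g] using h1
  let R : Matrix (Fin d) (Fin d) ℂ →ₗ[ℝ] Matrix (Fin d') (Fin d') ℂ :=
    hermitianPart ∘ₗ L ∘ₗ hermitianPart
  have hRH : ∀ X, (R X).IsHermitian := fun X => isHermitian_hermitianPart _
  -- The complexification of `R`: on Hermitian `X` the second term vanishes, since $iX$ has zero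
  -- Hermitian part.
  let C : Matrix (Fin d) (Fin d) ℂ →ₗ[ℂ] Matrix (Fin d') (Fin d') ℂ :=
    { toFun := fun X => R X - Complex.I • R (Complex.I • X)
      map_add' := fun X Y => by
        simp only [smul_add, map_add]
        abel
      map_smul' := fun c X => by
        have h1 : c • X = c.re • X + c.im • Complex.I • X := by
          ext a b
          apply Complex.ext <;> simp <;> ring
        have h2 : Complex.I • c • X = c.re • Complex.I • X - c.im • X := by
          ext a b
          apply Complex.ext <;> simp <;> ring
        rw [h2, h1]
        simp only [map_add, map_sub, map_smul, RingHom.id_apply]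
        simp only [← Complex.coe_smul]
        conv_rhs => rw [← Complex.re_add_im c]
        match_scalars
        · ring
        · linear_combination (c.im : ℂ) * Complex.I_sq }
  have hC : ∀ X : Matrix (Fin d) (Fin d) ℂ, X.IsHermitian → C X = R X := fun X hX => by
    have h0 : hermitianPart (Complex.I • X) = 0 := by simp [hermitianPart_apply, hX.eq]
    simp [C, R, h0]
  refine ⟨C, fun X hX => hC X hX ▸ hRH X, funext fun i => ?_⟩
  rw [Function.comp_apply, hC _ (hρ i)]
  simp only [R, LinearMap.comp_apply]
  rw [hermitianPart_eq_self (hρ i), hL, hermitianPart_eq_self (hσ i)]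

theorem exists_isPositiveOn_modelSupport {n d d' : ℕ}
    {ρ : Fin n → Matrix (Fin d) (Fin d) ℂ} {σ : Fin n → Matrix (Fin d') (Fin d') ℂ}
    (hρ : IsStatModel ρ) (hσ : IsStatModel σ) (h : testingRegion σ ⊆ testingRegion ρ) :
    ∃ C : Matrix (Fin d) (Fin d) ℂ →ₗ[ℂ] Matrix (Fin d') (Fin d') ℂ,
      IsHermitianPreserving C ∧ IsPositiveOn C (modelSupport ρ) ∧ C ∘ ρ = σ := by
  obtain ⟨C, hC, hCρ⟩ := exists_isHermitianPreserving_comp_eq (fun i => (hρ i).isHermitian)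
    (fun i => (hσ i).isHermitian) (sum_eq_zero_of_testingRegion_subset hσ h)
  refine ⟨C, hC, fun X hX hpos => ?_, hCρ⟩
  obtain ⟨t, rfl⟩ := (Submodule.mem_span_range_iff_exists_fun ℝ).mp hX
  have : C (∑ i, t i • ρ i) = ∑ i, t i • σ i := by
    rw [map_sum]
    exact Finset.sum_congr rfl fun i _ => by
      rw [LinearMap.map_smul_of_tower, ← hCρ, Function.comp_apply]
  rw [this]
  exact posSemidef_sum_of_testingRegion_subset hσ h t hpos

end PositiveOnSupport

/-! ### Kraus maps are channels. -/

section Kraus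

/-- The map `X ↦ ∑ᵢ Kᵢ X Kᵢᴴ` with Kraus operators `Kᵢ`. -/
noncomputable def krausMap {d : ℕ} {ι : Type*} [Fintype ι] (K : ι → Matrix (Fin d) (Fin d) ℂ) :
    Matrix (Fin d) (Fin d) ℂ →ₗ[ℂ] Matrix (Fin d) (Fin d) ℂ where
  toFun X := ∑ i, K i * X * (K i)ᴴ
  map_add' X Y := by simp only [mul_add, add_mul, Finset.sum_add_distrib]
  map_smul' c X := by simp only [Matrix.mul_smul, Matrix.smul_mul, Finset.smul_sum, RingHom.id_apply]

theorem krausMap_apply {d : ℕ} {ι : Type*} [Fintype ι] (K : ι → Matrix (Fin d) (Fin d) ℂ)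
    (X : Matrix (Fin d) (Fin d) ℂ) : krausMap K X = ∑ i, K i * X * (K i)ᴴ := rfl

open scoped CStarAlgebra MatrixOrder Matrix.Norms.L2Operator in
-- Positive matrices over the algebra are generated additively by $N^*N$, and the entrywise map
-- sends $N^*N$ to $\sum_i(NK_i^*)^*(NK_i^*)$, with $K_i^*$ multiplying each entry on the right.
theorem isCPMap_krausMap {d : ℕ} {ι : Type*} [Fintype ι] (K : ι → Matrix (Fin d) (Fin d) ℂ) :
    IsCPMap (krausMap K) := by
  refine ⟨⟨krausMap K, fun k M hM => ?_⟩, rfl⟩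
  rw [StarOrderedRing.nonneg_iff] at hM
  induction hM using AddSubmonoid.closure_induction with
  | mem _ h =>
    obtain ⟨N, rfl⟩ := h
    have : (star N * N).map (krausMap K) = ∑ i, star (N.map fun X => X * (K i)ᴴ) *
        (N.map fun X => X * (K i)ᴴ) := by
      ext1 a b
      let ev : CStarMatrix (Fin k) (Fin k) (Matrix (Fin d) (Fin d) ℂ) →+ Matrix (Fin d) (Fin d) ℂ :=
        { toFun := fun X => X a b
          map_zero' := rfl
          map_add' := fun _ _ => rfl }
      have hev : ∀ X, X a b = ev X := fun _ => rfl
      rw [CStarMatrix.map_apply, hev (∑ i, _), map_sum]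
      simp only [← hev, CStarMatrix.mul_apply, CStarMatrix.star_apply, CStarMatrix.map_apply, map_sum]
      rw [Finset.sum_comm]
      refine Finset.sum_congr rfl fun j _ => ?_
      rw [krausMap_apply]
      refine Finset.sum_congr rfl fun i _ => ?_
      simp only [star_mul, Matrix.star_eq_conjTranspose, Matrix.conjTranspose_conjTranspose,
        Matrix.mul_assoc]
    rw [this]
    exact Finset.sum_nonneg fun i _ => star_mul_self_nonneg _
  | zero =>
    have : (0 : CStarMatrix (Fin k) (Fin k) (Matrix (Fin d) (Fin d) ℂ)).map (krausMap K) = 0 := by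
      ext1 a b
      simp
    exact this.ge
  | add M N _ _ hM hN =>
    have : (M + N).map (krausMap K) = M.map (krausMap K) + N.map (krausMap K) := by
      ext1 a b
      simp
    exact (add_nonneg hM hN).trans this.ge

theorem isQChannel_krausMap {d : ℕ} {ι : Type*} [Fintype ι] {K : ι → Matrix (Fin d) (Fin d) ℂ}
    (hK : ∑ i, (K i)ᴴ * K i = 1) : IsQChannel (krausMap K) := by
  refine ⟨isCPMap_krausMap K, fun X => ?_⟩
  rw [krausMap_apply, Matrix.trace_sum]
  simp_rw [fun i => Matrix.trace_mul_comm (K i * X) (K i)ᴴ, ← Matrix.mul_assoc]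
  rw [← Matrix.trace_sum, ← Finset.sum_mul, hK, one_mul]

/-- The channel with constant output. -/
theorem exists_isQChannel_const {d : ℕ} {σ : Matrix (Fin d) (Fin d) ℂ} (hσ : IsQState σ) :
    ∃ C : Matrix (Fin d) (Fin d) ℂ →ₗ[ℂ] Matrix (Fin d) (Fin d) ℂ,
      IsQChannel C ∧ ∀ X, C X = X.trace • σ := by
  obtain ⟨B, rfl⟩ := hσ.1.exists_mul_conjTranspose
  -- The operators $B|i\rangle\langle j|$: summing over $j$ produces the trace of the input, and
  -- summing over $i$ produces $BB^*=\sigma$.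
  let K : Fin d × Fin d → Matrix (Fin d) (Fin d) ℂ := fun p => B * Matrix.single p.1 p.2 1
  refine ⟨krausMap K, isQChannel_krausMap ?_, fun X => ?_⟩
  · have hB : (Bᴴ * B).trace = 1 := by rw [Matrix.trace_mul_comm, hσ.2]
    ext a b
    have : ∀ p : Fin d × Fin d, ((K p)ᴴ * K p) a b
        = if a = p.2 ∧ b = p.2 then (Bᴴ * B) p.1 p.1 else 0 := fun p => by
      simp only [K, Matrix.conjTranspose_mul, Matrix.conjTranspose_single, star_one]
      rw [show Matrix.single p.2 p.1 (1 : ℂ) * Bᴴ * (B * Matrix.single p.1 p.2 1)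
        = Matrix.single p.2 p.1 1 * (Bᴴ * B) * Matrix.single p.1 p.2 1 by
          simp only [Matrix.mul_assoc]]
      rw [Matrix.single_mul_mul_single]
      simp [Matrix.single_apply, eq_comm]
    rw [Matrix.sum_apply]
    simp only [this, Fintype.sum_prod_type, Matrix.one_apply]
    rw [Finset.sum_comm]
    by_cases hab : a = b
    · subst hab
      simpa [Matrix.trace] using hB
    · rw [if_neg hab]
      refine Finset.sum_eq_zero fun j _ => Finset.sum_eq_zero fun i _ => if_neg ?_
      rintro ⟨rfl, rfl⟩
      exact hab rfl
  · have h1 : ∀ p : Fin d × Fin d, K p * X * (K p)ᴴ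
        = B * Matrix.single p.1 p.1 (X p.2 p.2) * Bᴴ := fun p => by
      simp only [K, Matrix.conjTranspose_mul, Matrix.conjTranspose_single, star_one]
      rw [show B * Matrix.single p.1 p.2 1 * X * (Matrix.single p.2 p.1 1 * Bᴴ)
        = B * (Matrix.single p.1 p.2 1 * X * Matrix.single p.2 p.1 1) * Bᴴ by
          simp only [Matrix.mul_assoc], Matrix.single_mul_mul_single]
      simp
    rw [krausMap_apply]
    simp only [h1, ← Finset.sum_mul, ← Finset.mul_sum]
    have h2 : ∑ p : Fin d × Fin d, Matrix.single p.1 p.1 (X p.2 p.2)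
        = X.trace • (1 : Matrix (Fin d) (Fin d) ℂ) := by
      rw [Fintype.sum_prod_type]
      ext a b
      simp [Matrix.sum_apply, Matrix.single_apply, Matrix.one_apply, Matrix.trace, ite_and]
    rw [h2]
    simp

end Kraus

/-! ### Alberti-Uhlmann theorem for pairs of qubit states. -/

section Qubit

/-- The Kraus operators are `[A eⱼ, τ B eⱼ] P⁻¹` and `[0, √(1 - |τ|²) B eⱼ] P⁻¹`. -/
theorem exists_isQChannel_of_gram {P A B : Matrix (Fin 2) (Fin 2) ℂ} (hP : IsUnit P.det) {τ : ℂ}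
    (hτ : ‖τ‖ ≤ 1) (h00 : (Pᴴ * P) 0 0 = (Aᴴ * A).trace) (h11 : (Pᴴ * P) 1 1 = (Bᴴ * B).trace)
    (h01 : (Pᴴ * P) 0 1 = τ * (Aᴴ * B).trace) :
    ∃ C : Matrix (Fin 2) (Fin 2) ℂ →ₗ[ℂ] Matrix (Fin 2) (Fin 2) ℂ, IsQChannel C ∧
      C (P * !![1, 0; 0, 0] * Pᴴ) = A * Aᴴ ∧ C (P * !![0, 0; 0, 1] * Pᴴ) = B * Bᴴ := by
  obtain ⟨s, hs⟩ : ∃ s : ℝ, (s : ℂ) * s + τ * star τ = 1 := by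
    refine ⟨√(1 - ‖τ‖ ^ 2), ?_⟩
    have h1 : 0 ≤ 1 - ‖τ‖ ^ 2 := by nlinarith [norm_nonneg τ]
    rw [← Complex.ofReal_mul, Real.mul_self_sqrt h1]
    have : τ * star τ = ((‖τ‖ ^ 2 : ℝ) : ℂ) := by simpa using Complex.mul_conj' τ
    rw [this]
    simp
  let T : Fin 2 ⊕ Fin 2 → Matrix (Fin 2) (Fin 2) ℂ :=
    Sum.elim (fun j => !![A 0 j, τ * B 0 j; A 1 j, τ * B 1 j])
      (fun j => !![0, s * B 0 j; 0, s * B 1 j])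
  have hPP : P⁻¹ * P = 1 := Matrix.nonsing_inv_mul P hP
  have hPP' : P * P⁻¹ = 1 := Matrix.mul_nonsing_inv P hP
  have hPh : Pᴴ * (P⁻¹)ᴴ = 1 := by rw [← Matrix.conjTranspose_mul, hPP, Matrix.conjTranspose_one]
  have hPh' : (P⁻¹)ᴴ * Pᴴ = 1 := by rw [← Matrix.conjTranspose_mul, hPP', Matrix.conjTranspose_one]
  have h10 : (Pᴴ * P) 1 0 = star τ * star (Aᴴ * B).trace := by
    rw [← star_mul', ← h01]
    simp [Matrix.mul_apply, Fin.sum_univ_two]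
    ring
  -- This is trace preservation for the operators $T_iP^{-1}$. The block weighted by `s` restores
  -- the part of $B$ lost to the contraction $\tau$ without changing the off-diagonal entries.
  have hT : ∑ i, (T i)ᴴ * T i = Pᴴ * P := by
    ext a b
    fin_cases a <;> fin_cases b
    · refine Eq.trans ?_ h00.symm
      simp [T, Matrix.mul_apply, Matrix.trace, Fin.sum_univ_two]
    · refine Eq.trans ?_ h01.symm
      simp [T, Matrix.mul_apply, Matrix.trace, Fin.sum_univ_two]
      ring
    · refine Eq.trans ?_ h10.symm
      simp [T, Matrix.mul_apply, Matrix.trace, Fin.sum_univ_two]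
      ring
    · refine Eq.trans ?_ h11.symm
      simp [T, Matrix.mul_apply, Matrix.trace, Fin.sum_univ_two] at hs ⊢
      linear_combination (B 0 0 * starRingEnd ℂ (B 0 0) + B 0 1 * starRingEnd ℂ (B 0 1) + B 1 0 * starRingEnd ℂ (B 1 0)
        + B 1 1 * starRingEnd ℂ (B 1 1)) * hs
  have hconj : ∀ E, krausMap (fun i => T i * P⁻¹) (P * E * Pᴴ) = ∑ i, T i * E * (T i)ᴴ := fun E => by
    rw [krausMap_apply]
    refine Finset.sum_congr rfl fun i _ => ?_
    rw [Matrix.conjTranspose_mul, show T i * P⁻¹ * (P * E * Pᴴ) * ((P⁻¹)ᴴ * (T i)ᴴ)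
      = T i * (P⁻¹ * P) * E * (Pᴴ * (P⁻¹)ᴴ) * (T i)ᴴ by simp only [Matrix.mul_assoc], hPP, hPh,
      mul_one, mul_one]
  refine ⟨krausMap fun i => T i * P⁻¹, isQChannel_krausMap ?_, ?_, ?_⟩
  · have : ∀ i, (T i * P⁻¹)ᴴ * (T i * P⁻¹) = (P⁻¹)ᴴ * ((T i)ᴴ * T i) * P⁻¹ := fun i => by
      simp only [Matrix.conjTranspose_mul, Matrix.mul_assoc]
    simp only [this, ← Finset.sum_mul, ← Finset.mul_sum, hT]
    rw [← Matrix.mul_assoc, hPh', one_mul, hPP']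
  · rw [hconj]
    ext a b
    fin_cases a <;> fin_cases b <;>
      simp [T, Matrix.mul_apply, Matrix.vecMul, dotProduct, Fin.sum_univ_two]
  · rw [hconj]
    ext a b
    fin_cases a <;> fin_cases b <;>
      simp [T, Matrix.mul_apply, Matrix.vecMul, dotProduct, Fin.sum_univ_two] at hs ⊢
    · linear_combination (B 0 0 * starRingEnd ℂ (B 0 0) + B 0 1 * starRingEnd ℂ (B 0 1)) * hs
    · linear_combination (B 0 0 * starRingEnd ℂ (B 1 0) + B 0 1 * starRingEnd ℂ (B 1 1)) * hs
    · linear_combination (B 1 0 * starRingEnd ℂ (B 0 0) + B 1 1 * starRingEnd ℂ (B 0 1)) * hs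
    · linear_combination (B 1 0 * starRingEnd ℂ (B 1 0) + B 1 1 * starRingEnd ℂ (B 1 1)) * hs

/-- The trace norm of a `2 × 2` matrix `M` is `√(tr Mᴴ M + 2 |det M|)`. -/
theorem exists_unitary_trace_mul_eq (M : Matrix (Fin 2) (Fin 2) ℂ) :
    ∃ W : Matrix (Fin 2) (Fin 2) ℂ, W * Wᴴ = 1 ∧
      (M * W).trace = (√((Mᴴ * M).trace.re + 2 * ‖M.det‖) : ℝ) := by
  have htr0 := (Matrix.posSemidef_conjTranspose_mul_self M).trace_nonneg
  obtain ⟨t, ht0, ht⟩ : ∃ t : ℝ, 0 ≤ t ∧ (Mᴴ * M).trace = t :=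
    ⟨_, (Complex.nonneg_iff.mp htr0).1, Complex.ext rfl (Complex.nonneg_iff.mp htr0).2.symm⟩
  obtain ⟨w, hw, hwd⟩ := Complex.exists_norm_eq_mul_self M.det
  rw [ht, Complex.ofReal_re]
  set F : ℝ := √(t + 2 * ‖M.det‖) with hF
  have hFF : (F : ℂ) * F = t + 2 * (w * M.det) := by
    rw [← hwd, ← Complex.ofReal_mul, hF, Real.mul_self_sqrt (by positivity)]
    simp
  rcases eq_or_ne F 0 with h0 | h0
  · have h1 : t + 2 * ‖M.det‖ = 0 := (Real.sqrt_eq_zero (by positivity)).mp h0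
    have h2 : t = 0 := by linarith [norm_nonneg M.det]
    have h3 : M = 0 := by
      rw [h2, Complex.ofReal_zero] at ht
      exact Matrix.trace_conjTranspose_mul_self_eq_zero_iff.mp ht
    exact ⟨1, by simp, by simp [h0, h3]⟩
  have hFc : (F : ℂ) ≠ 0 := by exact_mod_cast h0
  have hww : w * star w = 1 := by
    have : w * star w = ((‖w‖ ^ 2 : ℝ) : ℂ) := by simpa using Complex.mul_conj' w
    rw [this, hw]
    simp
  have hreal : star w * star M.det = w * M.det := by
    rw [mul_comm, ← star_mul, ← hwd]
    simp
  -- With the phase $w\det M=|\det M|$, this is $F$ times a unitary, and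
  -- $\mathrm{Tr}[MV]=\mathrm{Tr}[M^*M]+2|\det M|=F^2$.
  let V := Mᴴ + w • M.adjugate
  have hVV : V * Vᴴ = ((F : ℂ) * F) • (1 : Matrix (Fin 2) (Fin 2) ℂ) := by
    have e : (t : ℂ) = M 0 0 * star (M 0 0) + M 0 1 * star (M 0 1) + M 1 0 * star (M 1 0)
        + M 1 1 * star (M 1 1) := by
      rw [← ht]
      simp [Matrix.trace, Matrix.mul_apply, Fin.sum_univ_two]
      ring
    rw [hFF, e]
    rw [Matrix.det_fin_two] at hreal ⊢
    simp only [V, Matrix.adjugate_fin_two]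
    ext a b
    fin_cases a <;> fin_cases b <;>
      simp [Matrix.mul_apply, Fin.sum_univ_two] at hww hreal ⊢
    · linear_combination (M 1 1 * starRingEnd ℂ (M 1 1) + M 0 1 * starRingEnd ℂ (M 0 1)) * hww + hreal
    · linear_combination (-(M 1 1 * starRingEnd ℂ (M 1 0)) - M 0 1 * starRingEnd ℂ (M 0 0)) * hww
    · linear_combination (-(M 1 0 * starRingEnd ℂ (M 1 1)) - M 0 0 * starRingEnd ℂ (M 0 1)) * hww
    · linear_combination (M 1 0 * starRingEnd ℂ (M 1 0) + M 0 0 * starRingEnd ℂ (M 0 0)) * hww + hreal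
  refine ⟨(F : ℂ)⁻¹ • V, ?_, ?_⟩
  · rw [Matrix.conjTranspose_smul, Matrix.smul_mul, Matrix.mul_smul, hVV, smul_smul, smul_smul]
    simp only [star_inv₀, Complex.star_def, Complex.conj_ofReal]
    rw [show (F : ℂ)⁻¹ * (F : ℂ)⁻¹ * (F * F) = 1 by field_simp, one_smul]
  · have : (M * V).trace = F * F := by
      simp only [V, Matrix.mul_add, Matrix.mul_smul, Matrix.mul_adjugate, Matrix.trace_add,
        Matrix.trace_smul, hFF, Matrix.trace_mul_comm M, ht]
      simp
      ring
    rw [Matrix.mul_smul, Matrix.trace_smul, this, smul_eq_mul]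
    field_simp

/-- In size two the determinant is a quadratic form with this polar form. It turns determinants
along a line or pencil of states into overlaps. -/
theorem Matrix.det_real_smul_add_smul_fin_two (X Y : Matrix (Fin 2) (Fin 2) ℂ) (a b : ℝ) :
    (a • X + b • Y).det = a ^ 2 * X.det + b ^ 2 * Y.det
      + a * b * (X.trace * Y.trace - (X * Y).trace) := by
  simp only [Matrix.det_fin_two, Matrix.trace_fin_two, Matrix.mul_apply, Fin.sum_univ_two,
    Matrix.add_apply, Matrix.smul_apply, Complex.real_smul]
  ring

theorem Matrix.IsHermitian.trace_eq_re {d : ℕ} {X : Matrix (Fin d) (Fin d) ℂ}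
    (hX : X.IsHermitian) : X.trace = (X.trace.re : ℂ) := by
  refine (Complex.conj_eq_iff_re.mp ?_).symm
  rw [starRingEnd_apply, ← Matrix.trace_conjTranspose, hX.eq]

theorem Matrix.IsHermitian.det_eq_re {d : ℕ} {X : Matrix (Fin d) (Fin d) ℂ}
    (hX : X.IsHermitian) : X.det = (X.det.re : ℂ) := by
  refine (Complex.conj_eq_iff_re.mp ?_).symm
  rw [starRingEnd_apply, ← Matrix.det_conjTranspose, hX.eq]

/-- The determinant is minus the squared Bloch length, $-(X_{00}^2+|X_{01}|^2)$. -/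
theorem Matrix.IsHermitian.det_re_neg_of_trace_eq_zero {X : Matrix (Fin 2) (Fin 2) ℂ}
    (hX : X.IsHermitian) (htr : X.trace = 0) (h0 : X ≠ 0) : X.det.re < 0 := by
  have h11 : X 1 1 = -X 0 0 := by
    rw [Matrix.trace_fin_two] at htr
    linear_combination htr
  have h10 : X 1 0 = star (X 0 1) := (hX.apply 1 0).symm
  have h00 : (X 0 0).im = 0 := Complex.conj_eq_iff_im.mp (hX.apply 0 0)
  have hdet : X.det.re = -((X 0 0).re ^ 2 + (X 0 1).re ^ 2 + (X 0 1).im ^ 2) := by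
    rw [Matrix.det_fin_two, h11, h10]
    simp [h00]
    ring
  rw [hdet, neg_lt_zero]
  by_contra hle
  have e1 : (X 0 0).re = 0 := by nlinarith [sq_nonneg (X 0 0).re, sq_nonneg (X 0 1).re, sq_nonneg (X 0 1).im]
  have e2 : (X 0 1).re = 0 := by nlinarith [sq_nonneg (X 0 0).re, sq_nonneg (X 0 1).re, sq_nonneg (X 0 1).im]
  have e3 : (X 0 1).im = 0 := by nlinarith [sq_nonneg (X 0 0).re, sq_nonneg (X 0 1).re, sq_nonneg (X 0 1).im]
  have f1 : X 0 0 = 0 := Complex.ext e1 h00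
  have f2 : X 0 1 = 0 := Complex.ext e2 e3
  refine h0 ?_
  ext i j
  fin_cases i <;> fin_cases j <;> simp [f1, f2, h11, h10]

/-- A factorization of two positive semidefinite matrices attaining their fidelity. -/
theorem exists_factor_trace_eq_fidelity {σ τ : Matrix (Fin 2) (Fin 2) ℂ} (hσ : σ.PosSemidef)
    (hτ : τ.PosSemidef) : ∃ A B : Matrix (Fin 2) (Fin 2) ℂ, A * Aᴴ = σ ∧ B * Bᴴ = τ ∧
      (Aᴴ * B).trace = (√((σ * τ).trace.re + 2 * √(σ.det.re * τ.det.re)) : ℝ) := by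
  obtain ⟨A, rfl⟩ := hσ.exists_mul_conjTranspose
  obtain ⟨B, rfl⟩ := hτ.exists_mul_conjTranspose
  obtain ⟨W, hW, htr⟩ := exists_unitary_trace_mul_eq (Aᴴ * B)
  refine ⟨A, B * W, rfl, ?_, ?_⟩
  · rw [Matrix.conjTranspose_mul, show B * W * (Wᴴ * Bᴴ) = B * (W * Wᴴ) * Bᴴ by
      simp only [Matrix.mul_assoc], hW, mul_one]
  · rw [← Matrix.mul_assoc, htr]
    have h1 : ((Aᴴ * B)ᴴ * (Aᴴ * B)).trace = (A * Aᴴ * (B * Bᴴ)).trace := by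
      rw [Matrix.conjTranspose_mul, Matrix.conjTranspose_conjTranspose, Matrix.trace_mul_comm,
        Matrix.trace_mul_comm]
      simp only [Matrix.mul_assoc]
      rw [Matrix.trace_mul_comm]
      simp only [Matrix.mul_assoc]
    have h2 : ∀ X : Matrix (Fin 2) (Fin 2) ℂ, (X * Xᴴ).det.re = ‖X.det‖ ^ 2 := fun X => by
      rw [Matrix.det_mul, Matrix.det_conjTranspose, Complex.star_def, Complex.mul_conj']
      norm_cast
    rw [h1, h2, h2, ← mul_pow, Real.sqrt_sq (by positivity), Matrix.det_mul, norm_mul,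
      Matrix.det_conjTranspose, norm_star]

/-- A Hermitian matrix of unit trace and vanishing determinant is a pure state. -/
theorem Matrix.IsHermitian.exists_eq_mul_star {α : Matrix (Fin 2) (Fin 2) ℂ} (hα : α.IsHermitian)
    (htr : α.trace = 1) (hdet : α.det = 0) : ∃ ψ : Fin 2 → ℂ, ∀ i j, α i j = ψ i * star (ψ j) := by
  obtain ⟨p, hp⟩ : ∃ p : ℝ, α 0 0 = p := ⟨_, (Complex.conj_eq_iff_re.mp (hα.apply 0 0)).symm⟩
  have h10 : α 1 0 = star (α 0 1) := (hα.apply 1 0).symm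
  rw [Matrix.trace_fin_two, hp] at htr
  have h11 : α 1 1 = 1 - p := by linear_combination htr
  have hz : (α 0 1) * star (α 0 1) = p * (1 - p) := by
    rw [Matrix.det_fin_two, hp, h11, h10] at hdet
    linear_combination -hdet
  have hz' : ‖α 0 1‖ ^ 2 = p * (1 - p) := by
    rw [Complex.star_def, Complex.mul_conj'] at hz
    exact_mod_cast hz
  have hp0 : 0 ≤ p := by nlinarith [sq_nonneg ‖α 0 1‖, sq_nonneg p]
  rcases hp0.eq_or_lt with rfl | hp1
  · have h01 : α 0 1 = 0 := by simpa using hz'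
    refine ⟨![0, 1], fun i j => ?_⟩
    fin_cases i <;> fin_cases j <;> simp [hp, h11, h10, h01]
  -- For $p>0$ the vector is the first column of $\alpha$ divided by $\sqrt p$.
  · obtain ⟨r, hr, hr0⟩ : ∃ r : ℝ, r * r = p ∧ 0 < r :=
      ⟨√p, Real.mul_self_sqrt hp1.le, Real.sqrt_pos.mpr hp1⟩
    have hrc : (r : ℂ) ≠ 0 := by exact_mod_cast hr0.ne'
    have hrp : (r : ℂ) * r = p := by exact_mod_cast hr
    refine ⟨![r, star (α 0 1) / r], fun i j => ?_⟩
    fin_cases i <;> fin_cases j <;> simp [hp, h11, h10] at hz ⊢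
    · exact hrp.symm
    · field_simp
    · field_simp
    · field_simp
      rw [← hrp] at hz ⊢
      linear_combination -hz

/-- The columns of $P$ are the two state vectors. They are independent, since otherwise
$\det(\alpha-\beta)=-|\det P|^2$ would vanish, although $\alpha-\beta$ is nonzero, Hermitian and
traceless. -/
theorem exists_conj_eq_pure_pair {α β : Matrix (Fin 2) (Fin 2) ℂ} (hα : α.IsHermitian)
    (hβ : β.IsHermitian) (hα1 : α.trace = 1) (hβ1 : β.trace = 1) (hα0 : α.det = 0)
    (hβ0 : β.det = 0) (hne : α ≠ β) : ∃ P : Matrix (Fin 2) (Fin 2) ℂ, IsUnit P.det ∧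
      P * !![1, 0; 0, 0] * Pᴴ = α ∧ P * !![0, 0; 0, 1] * Pᴴ = β ∧ (Pᴴ * P) 0 0 = 1 ∧
      (Pᴴ * P) 1 1 = 1 ∧ ‖(Pᴴ * P) 0 1‖ ^ 2 = (α * β).trace.re := by
  obtain ⟨ψ, hψ⟩ := hα.exists_eq_mul_star hα1 hα0
  obtain ⟨φ, hφ⟩ := hβ.exists_eq_mul_star hβ1 hβ0
  let P : Matrix (Fin 2) (Fin 2) ℂ := !![ψ 0, φ 0; ψ 1, φ 1]
  have hPα : P * !![1, 0; 0, 0] * Pᴴ = α := by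
    ext i j
    rw [hψ]
    fin_cases i <;> fin_cases j <;>
      simp [P, Matrix.mul_apply, Fin.sum_univ_two]
  have hPβ : P * !![0, 0; 0, 1] * Pᴴ = β := by
    ext i j
    rw [hφ]
    fin_cases i <;> fin_cases j <;>
      simp [P, Matrix.mul_apply, Fin.sum_univ_two]
  refine ⟨P, ?_, hPα, hPβ, ?_, ?_, ?_⟩
  · rw [isUnit_iff_ne_zero]
    intro h0
    have h1 := (hα.sub hβ).det_re_neg_of_trace_eq_zero (by rw [Matrix.trace_sub, hα1, hβ1, sub_self])
      (sub_ne_zero.mpr hne)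
    rw [← hPα, ← hPβ, ← sub_mul, ← mul_sub, Matrix.det_mul, Matrix.det_mul, h0] at h1
    simp at h1
  · rw [Matrix.trace_fin_two, hψ, hψ] at hα1
    simp [P, Matrix.mul_apply, Fin.sum_univ_two] at hα1 ⊢
    linear_combination hα1
  · rw [Matrix.trace_fin_two, hφ, hφ] at hβ1
    simp [P, Matrix.mul_apply, Fin.sum_univ_two] at hβ1 ⊢
    linear_combination hβ1
  · have h1 : (α * β).trace = (Pᴴ * P) 0 1 * star ((Pᴴ * P) 0 1) := by
      simp [Matrix.trace_fin_two, Matrix.mul_apply, Fin.sum_univ_two, hψ, hφ, P]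
      ring
    rw [h1, Complex.star_def, Complex.mul_conj']
    norm_cast

/-- Uhlmann: a pair of pure qubit states is mapped by a channel to any pair of qubit states whose
fidelity is not smaller. -/
theorem exists_isQChannel_pure_pair {α β σ τ : Matrix (Fin 2) (Fin 2) ℂ} (hα : α.IsHermitian)
    (hβ : β.IsHermitian) (hα1 : α.trace = 1) (hβ1 : β.trace = 1) (hα0 : α.det = 0)
    (hβ0 : β.det = 0) (hne : α ≠ β) (hσ : IsQState σ) (hτ : IsQState τ)
    (h : (α * β).trace.re ≤ (σ * τ).trace.re + 2 * √(σ.det.re * τ.det.re)) :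
    ∃ C : Matrix (Fin 2) (Fin 2) ℂ →ₗ[ℂ] Matrix (Fin 2) (Fin 2) ℂ,
      IsQChannel C ∧ C α = σ ∧ C β = τ := by
  obtain ⟨P, hP, hPα, hPβ, h00, h11, h01⟩ := exists_conj_eq_pure_pair hα hβ hα1 hβ1 hα0 hβ0 hne
  obtain ⟨A, B, rfl, rfl, hF⟩ := exists_factor_trace_eq_fidelity hσ.1 hτ.1
  set F := √((A * Aᴴ * (B * Bᴴ)).trace.re + 2 * √((A * Aᴴ).det.re * (B * Bᴴ).det.re))
  set z := (Pᴴ * P) 0 1 with hz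
  -- The fidelity hypothesis makes $z/F$ a contraction. If $F=0$ then $z=0$, and the quotient is
  -- harmlessly $0$.
  have hzF : ‖z‖ ≤ F := Real.le_sqrt_of_sq_le (h01 ▸ h)
  have hF0 : 0 ≤ F := Real.sqrt_nonneg _
  obtain ⟨C, hC, hCα, hCβ⟩ := exists_isQChannel_of_gram (A := A) (B := B) (τ := z / F) hP
    (by
      rw [norm_div, Complex.norm_real, Real.norm_eq_abs, abs_of_nonneg hF0]
      exact div_le_one_of_le₀ hzF hF0)
    (by rw [h00, Matrix.trace_mul_comm, hσ.2]) (by rw [h11, Matrix.trace_mul_comm, hτ.2])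
    (by
      rw [hF, ← hz]
      rcases hF0.eq_or_lt with h0 | h0
      · have : z = 0 := by simpa [← h0] using hzF
        simp [this]
      · have : (F : ℂ) ≠ 0 := by exact_mod_cast h0.ne'
        field_simp)
  exact ⟨C, hC, hPα ▸ hCα, hPβ ▸ hCβ⟩

/-- The spectral decomposition of a Hermitian `2 × 2` matrix with eigenvalues `(t ± s) / 2`. -/
theorem Matrix.IsHermitian.exists_spectral_projection {H : Matrix (Fin 2) (Fin 2) ℂ}
    (hH : H.IsHermitian) {t s : ℝ} (ht : H.trace = t) (hs0 : 0 < s)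
    (hs : s ^ 2 = t ^ 2 - 4 * H.det.re) : ∃ P : Matrix (Fin 2) (Fin 2) ℂ, P.IsHermitian ∧
      P * P = P ∧ P.trace = 1 ∧ H = ((t + s) / 2) • P + ((t - s) / 2) • (1 - P) := by
  set D := H.det.re
  have hD : H.det = D := hH.det_eq_re
  -- Cayley-Hamilton.
  have hCH : H * H = t • H - D • (1 : Matrix (Fin 2) (Fin 2) ℂ) := by
    rw [← Complex.coe_smul, ← Complex.coe_smul, ← ht, ← hD]
    ext i j
    fin_cases i <;> fin_cases j <;>
      simp [Matrix.mul_apply, Fin.sum_univ_two, Matrix.trace_fin_two, Matrix.det_fin_two] <;> ring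
  obtain ⟨m, hm⟩ : ∃ m : ℝ, m = (t - s) / 2 := ⟨_, rfl⟩
  -- With $m$ the smaller eigenvalue, $H-m$ is the gap $s$ times the projection sought.
  have hmul : (H - m • 1) * (H - m • 1) = s • (H - m • (1 : Matrix (Fin 2) (Fin 2) ℂ)) := by
    have h1 : (H - m • 1) * (H - m • 1)
        = H * H - (2 * m) • H + (m ^ 2) • (1 : Matrix (Fin 2) (Fin 2) ℂ) := by
      simp only [sub_mul, mul_sub, Matrix.smul_mul, Matrix.mul_smul, mul_one, one_mul]
      module
    rw [h1, hCH, hm]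
    match_scalars
    · ring
    · linear_combination (-1 / 4) * hs
  refine ⟨s⁻¹ • (H - m • 1), ?_, ?_, ?_, ?_⟩
  · rw [Matrix.IsHermitian, Matrix.conjTranspose_smul, star_trivial,
      (hH.sub (Matrix.isHermitian_real_smul_one m)).eq]
  · rw [Matrix.smul_mul, Matrix.mul_smul, hmul, smul_smul s⁻¹ s, inv_mul_cancel₀ hs0.ne', one_smul]
  · rw [Matrix.trace_smul, Matrix.trace_sub, ht, Matrix.trace_smul, Matrix.trace_one, hm]
    have : (s : ℂ) ≠ 0 := by exact_mod_cast hs0.ne'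
    simp only [Fintype.card_fin, Complex.real_smul]
    push_cast
    field_simp
    ring
  · rw [hm]
    match_scalars
    · field_simp
      ring
    · field_simp
      ring

/-- If every value `tr H π` on an effect is attained by `H'`, of the same trace and negative
determinant, then `det H' ≤ det H`. -/
theorem det_re_le_of_effects {H H' : Matrix (Fin 2) (Fin 2) ℂ} (hH : H.IsHermitian)
    (hH' : H'.IsHermitian) (htr : H.trace = H'.trace) (hneg : H'.det.re < 0)
    (h : ∀ π, IsQEffect π → ∃ τ, IsQEffect τ ∧ (H * π).trace.re = (H' * τ).trace.re) :
    H'.det.re ≤ H.det.re := by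
  by_contra! hlt
  set t := H.trace.re
  have ht : H.trace = t := hH.trace_eq_re
  have key : ∀ x : ℝ, x < 0 → 0 < √(t ^ 2 - 4 * x) ∧ √(t ^ 2 - 4 * x) ^ 2 = t ^ 2 - 4 * x :=
    fun x hx => ⟨Real.sqrt_pos.mpr (by nlinarith [sq_nonneg t]),
      Real.sq_sqrt (by nlinarith [sq_nonneg t])⟩
  obtain ⟨hs0, hs⟩ := key _ (hlt.trans hneg)
  obtain ⟨hs0', hs'⟩ := key _ hneg
  set s := √(t ^ 2 - 4 * H.det.re)
  set s' := √(t ^ 2 - 4 * H'.det.re)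
  have hss : s' < s := lt_of_pow_lt_pow_left₀ 2 hs0.le (by rw [hs, hs']; linarith)
  obtain ⟨P, hP, hPP, hP1, hHP⟩ := hH.exists_spectral_projection ht hs0 hs
  obtain ⟨P', hP', hPP', hP1', hHP'⟩ := hH'.exists_spectral_projection (htr ▸ ht) hs0' hs'
  -- The projection for the larger eigenvalue attains $(t+s)/2$. A matching effect on `H'` would
  -- have to exceed the larger eigenvalue $(t+s')/2$.
  obtain ⟨τ, hτ, e⟩ := h P (.of_isHermitian_of_mul_self hP hPP)
  have e1 : (H * P).trace.re = (t + s) / 2 := by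
    rw [hHP, add_mul, Matrix.smul_mul, Matrix.smul_mul, sub_mul, one_mul, hPP, sub_self, smul_zero,
      add_zero, Matrix.trace_smul, hP1]
    simp
  have hE' := IsQEffect.of_isHermitian_of_mul_self hP' hPP'
  have p1 : (P' * τ).trace.re ≤ 1 := by
    have := (Complex.nonneg_iff.mp (hE'.1.trace_mul_nonneg hτ.2)).1
    rw [mul_sub, mul_one, Matrix.trace_sub, hP1'] at this
    simpa using this
  have p2 : 0 ≤ ((1 - P') * τ).trace.re := (Complex.nonneg_iff.mp (hE'.2.trace_mul_nonneg hτ.1)).1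
  have e2 : (H' * τ).trace.re
      = (t + s') / 2 * (P' * τ).trace.re + (t - s') / 2 * ((1 - P') * τ).trace.re := by
    conv_lhs => rw [hHP']
    rw [add_mul, Matrix.smul_mul, Matrix.smul_mul, Matrix.trace_add, Matrix.trace_smul,
      Matrix.trace_smul]
    simp
  -- Since $\det H'<0$, the eigenvalues of $H'$ satisfy $(t-s')/2\le0\le(t+s')/2$, so no effect
  -- gives more than $(t+s')/2$.
  have habs : |t| ≤ s' := Real.le_sqrt_of_sq_le (by rw [sq_abs]; linarith)
  have h1 := abs_le.mp habs
  rw [e1, e2] at e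
  nlinarith

/-- The form is tightest at $(a,b)=(\sqrt y,\sqrt x)$. If $x$ or $y$ vanishes this point leaves the
open quadrant, and a large ratio of $a$ and $b$ is used instead. -/
theorem add_two_mul_sqrt_nonneg {x y k : ℝ} (hx : 0 ≤ x) (hy : 0 ≤ y)
    (h : ∀ a b : ℝ, 0 < a → 0 < b → 0 ≤ a ^ 2 * x + b ^ 2 * y + a * b * k) :
    0 ≤ k + 2 * √(x * y) := by
  rcases hx.eq_or_lt with rfl | hx
  · by_contra! hk
    simp only [zero_mul, Real.sqrt_zero, mul_zero, add_zero] at hk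
    -- Chosen so that the form takes the value $-1$.
    have := h ((y + 1) / -k) 1 (div_pos (by linarith) (by linarith)) one_pos
    have e : (y + 1) / -k * 1 * k = -(y + 1) := by
      have := hk.ne
      field_simp
    rw [e] at this
    linarith
  rcases hy.eq_or_lt with rfl | hy
  · by_contra! hk
    simp only [mul_zero, Real.sqrt_zero, add_zero] at hk
    have := h 1 ((x + 1) / -k) one_pos (div_pos (by linarith) (by linarith))
    have e : 1 * ((x + 1) / -k) * k = -(x + 1) := by
      have := hk.ne
      field_simp
    rw [e] at this
    linarith
  have hx' := Real.sqrt_pos.mpr hx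
  have hy' := Real.sqrt_pos.mpr hy
  have h1 := h (√y) (√x) hy' hx'
  rw [Real.sq_sqrt hx.le, Real.sq_sqrt hy.le] at h1
  rw [Real.sqrt_mul hx.le]
  have h2 : 0 ≤ √x * √y * (k + 2 * (√x * √y)) := by
    have e1 := Real.mul_self_sqrt hx.le
    have e2 := Real.mul_self_sqrt hy.le
    calc (0 : ℝ) ≤ _ := h1
      _ = √y * √x * k + 2 * (x * y) := by ring
      _ = √y * √x * k + 2 * ((√x * √x) * (√y * √y)) := by rw [e1, e2]
      _ = _ := by ring
  exact nonneg_of_mul_nonneg_right h2 (mul_pos hx' hy')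

/-- The affine line through two distinct qubit states contains two distinct pure states. -/
theorem exists_pure_pair_on_line {ρ₀ ρ₁ : Matrix (Fin 2) (Fin 2) ℂ} (h₀ : IsQState ρ₀)
    (h₁ : IsQState ρ₁) (hne : ρ₀ ≠ ρ₁) : ∃ x y : ℝ, x ≠ y ∧
      ((1 - x) • ρ₀ + x • ρ₁).det = 0 ∧ ((1 - y) • ρ₀ + y • ρ₁).det = 0 := by
  obtain ⟨D₀, e₀, hD₀⟩ : ∃ D : ℝ, ρ₀.det = D ∧ 0 ≤ D :=
    ⟨_, h₀.isHermitian.det_eq_re, (Complex.nonneg_iff.mp h₀.1.det_nonneg).1⟩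
  obtain ⟨D₁, e₁, hD₁⟩ : ∃ D : ℝ, ρ₁.det = D ∧ 0 ≤ D :=
    ⟨_, h₁.isHermitian.det_eq_re, (Complex.nonneg_iff.mp h₁.1.det_nonneg).1⟩
  obtain ⟨T, hT⟩ : ∃ T : ℝ, (ρ₀ * ρ₁).trace = T :=
    ⟨_, Complex.ext rfl (Complex.nonneg_iff.mp (h₀.1.trace_mul_nonneg h₁.1)).2.symm⟩
  have hdet : ∀ a b : ℝ, (a • ρ₀ + b • ρ₁).det
      = ((a ^ 2 * D₀ + b ^ 2 * D₁ + a * b * (1 - T) : ℝ) : ℂ) := fun a b => by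
    rw [Matrix.det_real_smul_add_smul_fin_two, e₀, e₁, hT, h₀.2, h₁.2]
    push_cast
    ring
  -- This is $\det(\rho_0-\rho_1)$, the leading coefficient of $x\mapsto\det((1-x)\rho_0+x\rho_1)$.
  -- It gives $1-T>D_0+D_1\ge0$, so the discriminant $(1-T)^2-4D_0D_1$ is positive.
  have hδ : D₀ + D₁ - (1 - T) < 0 := by
    have := (h₀.isHermitian.sub h₁.isHermitian).det_re_neg_of_trace_eq_zero
      (by rw [Matrix.trace_sub, h₀.2, h₁.2, sub_self]) (sub_ne_zero.mpr hne)
    have e := hdet 1 (-1)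
    rw [one_smul, neg_one_smul, ← sub_eq_add_neg] at e
    rw [e, Complex.ofReal_re] at this
    linarith
  set δ := D₀ + D₁ - (1 - T) with hδ'
  have hdisc : 0 < (1 - T) ^ 2 - 4 * D₀ * D₁ := by nlinarith [sq_nonneg (D₀ - D₁)]
  set s := √((1 - T) ^ 2 - 4 * D₀ * D₁)
  have hs0 : 0 < s := Real.sqrt_pos.mpr hdisc
  have hs : s ^ 2 = (1 - T) ^ 2 - 4 * D₀ * D₁ := Real.sq_sqrt hdisc.le
  have hδ0 : δ ≠ 0 := hδ.ne
  have hroot : ∀ r : ℝ, r ^ 2 = (1 - T) ^ 2 - 4 * D₀ * D₁ →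
      ((1 - (2 * D₀ - (1 - T) + r) / (2 * δ)) • ρ₀
        + ((2 * D₀ - (1 - T) + r) / (2 * δ)) • ρ₁).det = 0 := fun r hr => by
    rw [hdet, Complex.ofReal_eq_zero]
    obtain ⟨x, hx⟩ : ∃ x, x = (2 * D₀ - (1 - T) + r) / (2 * δ) := ⟨_, rfl⟩
    rw [← hx]
    have hx' : 2 * δ * x = 2 * D₀ - (1 - T) + r := by
      rw [hx]
      field_simp
    have : 4 * δ * ((1 - x) ^ 2 * D₀ + x ^ 2 * D₁ + (1 - x) * x * (1 - T)) = 0 := by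
      have hr' : r = 2 * δ * x - (2 * D₀ - (1 - T)) := by linarith
      rw [hr'] at hr
      have h4 : δ = D₀ + D₁ - (1 - T) := hδ'
      linear_combination hr + (4 * D₀ - 4 * δ * x ^ 2) * h4
    exact (mul_eq_zero.mp this).resolve_left (by simpa using hδ0)
  refine ⟨_, _, ?_, hroot s hs, hroot (-s) (by rw [neg_sq, hs])⟩
  intro h
  field_simp at h
  linarith

/-- Alberti-Uhlmann: for pairs of qubit states, inclusion of the testing regions implies
simulability by a channel. -/
theorem exists_isQChannel_of_testingRegion_subset {ρ σ : Fin 2 → Matrix (Fin 2) (Fin 2) ℂ}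
    (hρ : IsStatModel ρ) (hσ : IsStatModel σ) (h : testingRegion σ ⊆ testingRegion ρ) :
    ∃ C : Matrix (Fin 2) (Fin 2) ℂ →ₗ[ℂ] Matrix (Fin 2) (Fin 2) ℂ, IsQChannel C ∧ C ∘ ρ = σ := by
  by_cases hne : ρ 0 = ρ 1
  · have h01 : σ 0 = σ 1 := by
      have := sum_eq_zero_of_testingRegion_subset hσ h ![1, -1] (by simp [Fin.sum_univ_two, hne])
      simpa [Fin.sum_univ_two, ← sub_eq_add_neg, sub_eq_zero] using this
    obtain ⟨C, hC, hCσ⟩ := exists_isQChannel_const (hσ 0)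
    refine ⟨C, hC, funext fun i => ?_⟩
    rw [Function.comp_apply, hCσ, (hρ i).2, one_smul]
    fin_cases i
    · rfl
    · exact h01
  obtain ⟨x, y, hxy, hx, hy⟩ := exists_pure_pair_on_line (hρ 0) (hρ 1) hne
  have hherm : ∀ {η : Fin 2 → Matrix (Fin 2) (Fin 2) ℂ}, IsStatModel η → ∀ a b : ℝ,
      (a • η 0 + b • η 1).IsHermitian := fun hη a b => by
    simp [Matrix.IsHermitian, (hη _).isHermitian.eq]
  have htr : ∀ {η : Fin 2 → Matrix (Fin 2) (Fin 2) ℂ}, IsStatModel η → ∀ a b : ℝ,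
      (a • η 0 + b • η 1).trace = ((a + b : ℝ) : ℂ) := fun hη a b => by
    simp [(hη _).2]
  have htr1 : ∀ {η : Fin 2 → Matrix (Fin 2) (Fin 2) ℂ}, IsStatModel η → ∀ a : ℝ,
      ((1 - a) • η 0 + a • η 1).trace = 1 := fun hη a => by
    rw [htr hη, sub_add_cancel, Complex.ofReal_one]
  -- A pure state on the source line may lie outside the segment, so positivity of its counterpart
  -- comes from the duality lemma and not from convexity.
  have hpos : ∀ a : ℝ, ((1 - a) • ρ 0 + a • ρ 1).det = 0 →
      IsQState ((1 - a) • σ 0 + a • σ 1) := fun a ha => by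
    have hα := hherm hρ (1 - a) a
    obtain ⟨ψ, hψ⟩ := hα.exists_eq_mul_star (htr1 hρ a) ha
    have hα' : (∑ i, ![1 - a, a] i • ρ i).PosSemidef := by
      convert Matrix.posSemidef_vecMulVec_self_star ψ using 1
      ext i j
      rw [Fin.sum_univ_two]
      exact hψ i j
    have := posSemidef_sum_of_testingRegion_subset hσ h ![1 - a, a] hα'
    rw [Fin.sum_univ_two] at this
    exact ⟨this, htr1 hσ a⟩
  set α := (1 - x) • ρ 0 + x • ρ 1 with hα
  set β := (1 - y) • ρ 0 + y • ρ 1 with hβ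
  have hαβ : α ≠ β := by
    intro e
    have e' : (x - y) • (ρ 1 - ρ 0) = 0 := by
      rw [← sub_eq_zero.mpr e, hα, hβ]
      module
    rcases smul_eq_zero.mp e' with e' | e'
    · exact hxy (sub_eq_zero.mp e')
    · exact hne (sub_eq_zero.mp e').symm
  have hαH : α.IsHermitian := hherm hρ _ _
  have hβH : β.IsHermitian := hherm hρ _ _
  have hS := hpos x hx
  have hT := hpos y hy
  set S := (1 - x) • σ 0 + x • σ 1 with hSdef
  set T := (1 - y) • σ 0 + y • σ 1 with hTdef
  have hdet1 : ∀ a b : ℝ, (a • α + (-b) • β).det.re = a * b * ((α * β).trace.re - 1) := fun a b => by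
    rw [Matrix.det_real_smul_add_smul_fin_two, hx, hy, htr1 hρ x, htr1 hρ y]
    simp [← Complex.ofReal_mul]
    ring
  have hdet2 : ∀ a b : ℝ, (a • S + (-b) • T).det.re
      = a ^ 2 * S.det.re + b ^ 2 * T.det.re + a * b * ((S * T).trace.re - 1) := fun a b => by
    rw [Matrix.det_real_smul_add_smul_fin_two, hS.2, hT.2]
    simp [← Complex.ofReal_mul, ← Complex.ofReal_pow]
    ring
  have hlt : (α * β).trace.re - 1 < 0 := by
    have := (hαH.sub hβH).det_re_neg_of_trace_eq_zero
      (by rw [Matrix.trace_sub, htr1 hρ, htr1 hρ, sub_self]) (sub_ne_zero.mpr hαβ)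
    have e := hdet1 1 1
    rw [one_smul, neg_one_smul, ← sub_eq_add_neg] at e
    linarith
  have hcomb : ∀ (η : Fin 2 → Matrix (Fin 2) (Fin 2) ℂ) (a b : ℝ),
      a • ((1 - x) • η 0 + x • η 1) + (-b) • ((1 - y) • η 0 + y • η 1)
        = ∑ i, ![a * (1 - x) - b * (1 - y), a * x - b * y] i • η i := fun η a b => by
    rw [Fin.sum_univ_two]
    simp only [Matrix.cons_val_zero, Matrix.cons_val_one]
    module
  -- The determinant comparison for all $a,b>0$ states that a quadratic form is nonnegative on the
  -- open quadrant.
  have hfid : (α * β).trace.re ≤ (S * T).trace.re + 2 * √(S.det.re * T.det.re) := by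
    have := add_two_mul_sqrt_nonneg (k := (S * T).trace.re - (α * β).trace.re)
      (Complex.nonneg_iff.mp hS.1.det_nonneg).1 (Complex.nonneg_iff.mp hT.1.det_nonneg).1
      fun a b ha hb => by
        have key := det_re_le_of_effects (H := a • S + (-b) • T) (H' := a • α + (-b) • β)
          (by simp [Matrix.IsHermitian, hS.isHermitian.eq, hT.isHermitian.eq])
          (by simp [Matrix.IsHermitian, hαH.eq, hβH.eq])
          (by
            rw [Matrix.trace_add, Matrix.trace_add, Matrix.trace_smul, Matrix.trace_smul,
              Matrix.trace_smul, Matrix.trace_smul, hS.2, hT.2, htr1 hρ, htr1 hρ])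
          (by rw [hdet1]; exact mul_neg_of_pos_of_neg (mul_pos ha hb) hlt)
          fun π hπ => by
            obtain ⟨τ, hτ, e⟩ := exists_effect_of_testingRegion_subset h hπ
            refine ⟨τ, hτ, ?_⟩
            rw [hSdef, hTdef, hα, hβ, hcomb, hcomb]
            exact e _
        rw [hdet1, hdet2] at key
        linarith
    linarith
  obtain ⟨C, hC, hCα, hCβ⟩ := exists_isQChannel_pure_pair hαH hβH (htr1 hρ x) (htr1 hρ y) hx hy hαβ
    hS hT hfid
  refine ⟨C, hC, ?_⟩
  have hxy' : y - x ≠ 0 := sub_ne_zero.mpr hxy.symm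
  -- Interpolation through the parameters $x\ne y$: the action on $\alpha,\beta$ determines the
  -- action on the whole line, and the original states are at $c=0,1$.
  have hline : ∀ (η : Fin 2 → Matrix (Fin 2) (Fin 2) ℂ) (c : ℝ), (1 - c) • η 0 + c • η 1
      = ((y - c) / (y - x)) • ((1 - x) • η 0 + x • η 1)
        + ((c - x) / (y - x)) • ((1 - y) • η 0 + y • η 1) := fun η c => by
    match_scalars
    · field_simp
      ring
    · field_simp
      ring
  have hC' : ∀ c : ℝ, C ((1 - c) • ρ 0 + c • ρ 1) = (1 - c) • σ 0 + c • σ 1 := fun c => by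
    rw [hline ρ, hline σ, map_add, LinearMap.map_smul_of_tower, LinearMap.map_smul_of_tower,
      ← hα, ← hβ, hCα, hCβ]
  funext i
  fin_cases i
  · simpa using hC' 0
  · simpa using hC' 1

end Qubit

/-! ### The simulability test. -/

theorem mainTheorem4 {n d₁ : ℕ} (Q : Set (Fin n → ℝ))
    (ρ₁ : Fin n → Matrix (Fin d₁) (Fin d₁) ℂ) (hρ₁ : IsStatModel ρ₁)
    (hQ : Q ⊆ testingRegion ρ₁)
    {d₀ : ℕ} (ρ₀ : Fin n → Matrix (Fin d₀) (Fin d₀) ℂ) (hρ₀ : IsStatModel ρ₀)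
    (hsub : modelDCone ρ₀ 1 ⊆ convexHull ℝ Q) :
    (∃ C : Matrix (Fin d₁) (Fin d₁) ℂ →ₗ[ℂ] Matrix (Fin d₀) (Fin d₀) ℂ,
      IsHermitianPreserving C ∧ IsPositiveOn C (modelSupport ρ₁) ∧ C ∘ ρ₁ = ρ₀) ∧
    (d₁ = 2 → d₀ = 2 → n = 2 →
      ∃ C : Matrix (Fin d₁) (Fin d₁) ℂ →ₗ[ℂ] Matrix (Fin d₀) (Fin d₀) ℂ,
        IsQChannel C ∧ C ∘ ρ₁ = ρ₀) := by
  have h : testingRegion ρ₀ ⊆ testingRegion ρ₁ :=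
    (testingRegion_subset_modelDCone hρ₀).trans <|
      hsub.trans <| convexHull_min hQ (convex_testingRegion ρ₁)
  refine ⟨exists_isPositiveOn_modelSupport hρ₁ hρ₀ h, ?_⟩
  rintro rfl rfl rfl
  exact exists_isQChannel_of_testingRegion_subset hρ₁ hρ₀ h
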